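/- Let $A=\mathbb{C}[q,q^{-1}]$, $K=\mathbb{C}(q)$, and let $0\le l\le n$ be integers. Let $\mathcal{F}_{n,l}$ be the $K[z_1^{\pm1},\dots,z_n^{\pm1}]$-module of all polynomials $P(X_1,\dots,X_l)$ with coefficients in $K[z_1^{\pm1},\dots,z_n^{\pm1}]$ that are symmetric in $X_1,\dots,X_l$, satisfy $\deg_{X_a}P\le n-1$ for every $a$, and, if $l\ge2$, satisfy $P|_{X_1=q^{-2}X_2=z_k^{-1}}=0$ for $1\le k\le n$. Put $$\mathcal{F}_{A,n,l}=\mathcal{F}_{n,l}\cap A[z_1^{\pm1},\dots,z_n^{\pm1}][X_1,\dots,X_l],$$ $$\widehat A_n=A[[z_1/z_2,\dots,z_{n-1}/z_n]][z_1^{\pm1},\dots,z_n^{\pm1}],\qquad \widehat{\mathcal{F}}_{A,n,l}=\mathcal{F}_{A,n,l}\otimes_{A[z_1^{\pm1},\dots,z_n^{\pm1}]}\widehat A_n .$$ For a subset $M=\{m_1<\cdots<m_l\}$ of $\{1,\dots,n\}$ with $\#M=l$, set $$w^{(n)}_M(X_1,\dots,X_l)=\sum_{\sigma\in\mathfrak{S}_l}\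 \prod_{a=1}^l G^{(n)}_{m_a}(X_{\sigma(a)})\prod_{1\le k<k'\le l}\frac{q^{-1}X_{\sigma(k)}-qX_{\sigma(k')}}{X_{\sigma(k)}-X_{\sigma(k')}},$$ $$G^{(n)}_m(X)=q^{m-n}\prod_{k=1}^{m-1}(1-q^{-2}z_kX)\prod_{k=m+1}^{n}(1-z_kX).$$ Then every $w^{(n)}_M$ with $\#M=l$ belongs to $\mathcal{F}_{A,n,l}$, and the elements $w^{(n)}_M\otimes1$, where $M$ runs over all subsets of $\{1,\dots,n\}$ with $\#M=l$, form a free basis of the $\widehat A_n$-module $\widehat{\mathcal{F}}_{A,n,l}$. -/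

import Mathlib

open scoped TensorProduct LaurentPolynomial

noncomputable section

namespace FunctionalModel

/-- `A = ℂ[q, q⁻¹]`; the indeterminate `q` is `LaurentPolynomial.T 1`. -/
abbrev A : Type := ℂ[T;T⁻¹]

/-- `K = ℂ(q)`; the indeterminate `q` is `RatFunc.X`. -/
abbrev K : Type := RatFunc ℂ

/-- `q` as a unit of `A`. -/
def qA : Aˣ where
  val := LaurentPolynomial.T 1
  inv := LaurentPolynomial.T (-1)
  val_inv := by rw [← LaurentPolynomial.T_add]; simp
  inv_val := by rw [← LaurentPolynomial.T_add]; simp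

/-- `q` as a unit of `K`. -/
def qK : Kˣ := Units.mk0 RatFunc.X RatFunc.X_ne_zero

/-- The inclusion `A → K`, `q ↦ q`. -/
def AtoK : A →+* K := LaurentPolynomial.eval₂ (algebraMap ℂ K) qK

/-- The ring `R[z_1^{±1}, …, z_n^{±1}]` of Laurent polynomials in `n` variables: the group algebra
of `ℤⁿ`.  The variables are indexed by `Fin n`, so that the variable `z_k` (`1 ≤ k ≤ n`) has index `k - 1`. -/
abbrev Laurent (R : Type) [CommRing R] (n : ℕ) : Type := AddMonoidAlgebra R (Fin n → ℤ)

section General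

variable (R : Type) [CommRing R]

/-- The Laurent monomial `z_k ^ e`. -/
def zpowVar (n : ℕ) (k : Fin n) (e : ℤ) : Laurent R n := AddMonoidAlgebra.single (Pi.single k e) 1

/-- The constant `q ^ e`, as a Laurent polynomial. -/
def qpow {R : Type} [CommRing R] (q : Rˣ) (n : ℕ) (e : ℤ) : Laurent R n :=
  algebraMap R (Laurent R n) ((q ^ e : Rˣ) : R)

/-- The substitution `X_1 = z_k⁻¹`, `X_2 = q² z_k⁻¹` (that is, `X_1 = q⁻² X_2 = z_k⁻¹`), all other
`X_a` being left untouched. -/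
def specializeAt {R : Type} [CommRing R] (q : Rˣ) (n l : ℕ) (k : Fin n) :
    MvPolynomial (Fin l) (Laurent R n) →ₐ[Laurent R n] MvPolynomial (Fin l) (Laurent R n) :=
  MvPolynomial.aeval fun a : Fin l =>
    if a.val = 0 then MvPolynomial.C (zpowVar R n k (-1))
    else if a.val = 1 then MvPolynomial.C (qpow q n 2 * zpowVar R n k (-1))
    else MvPolynomial.X a

/-- The `R[z^{±1}]`-module of the polynomials `P(X_1, …, X_l)` over `R[z_1^{±1}, …, z_n^{±1}]` that
are symmetric, of degree at most `n - 1` in each `X_a`, and, when `l ≥ 2`, vanish under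
`X_1 = q⁻² X_2 = z_k⁻¹` for every `k`.  It is used for `l ≤ n` only; then the existence of a
variable `X_a` forces `1 ≤ n`, and `n - 1` is the honest difference. -/
def functionSpace {R : Type} [CommRing R] (q : Rˣ) (n l : ℕ) :
    Submodule (Laurent R n) (MvPolynomial (Fin l) (Laurent R n)) where
  carrier := {P | P.IsSymmetric ∧ (∀ a : Fin l, P.degreeOf a ≤ n - 1) ∧
    (2 ≤ l → ∀ k : Fin n, specializeAt q n l k P = 0)}
  zero_mem' := ⟨MvPolynomial.IsSymmetric.zero, fun a => by simp, fun _ k => map_zero _⟩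
  add_mem' := by
    rintro P Q ⟨hP1, hP2, hP3⟩ ⟨hQ1, hQ2, hQ3⟩
    refine ⟨hP1.add hQ1, fun a => ?_, fun hl k => ?_⟩
    · exact (MvPolynomial.degreeOf_add_le a P Q).trans (max_le (hP2 a) (hQ2 a))
    · rw [map_add, hP3 hl k, hQ3 hl k, add_zero]
  smul_mem' := by
    rintro c P ⟨hP1, hP2, hP3⟩
    refine ⟨hP1.smul c, fun a => ?_, fun hl k => ?_⟩
    · rw [MvPolynomial.smul_eq_C_mul]
      exact (MvPolynomial.degreeOf_C_mul_le P a c).trans (hP2 a)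
    · rw [map_smul, hP3 hl k, smul_zero]

/-- The exponent group `ℤⁿ`, ordered lexicographically (the first coordinate counts first, so that
every `z_k / z_{k+1}` is positive).  The order only serves to place all formal series below in one
common ring of Hahn series. -/
abbrev Exponent (n : ℕ) : Type := Lex (Fin n → ℤ)

/-- The exponents of the monomials in `z_1/z_2, …, z_{n-1}/z_n`. -/
def cone (n : ℕ) : AddSubmonoid (Exponent n) :=
  AddSubmonoid.closure
    {α | ∃ i j : Fin n, i.val + 1 = j.val ∧ α = toLex (Pi.single i 1 - Pi.single j 1)}

/-- The ring `R[[z_1/z_2, …, z_{n-1}/z_n]][z_1^{±1}, …, z_n^{±1}]`, inside the formal series in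
`z_1^{±1}, …, z_n^{±1}`: it is generated by the power series in `z_1/z_2, …, z_{n-1}/z_n` (the
series whose exponents all lie in `cone n`; their coefficients are arbitrary) and by the `z_k^{±1}`.
-/
def hatRing (n : ℕ) : Subalgebra R (HahnSeries (Exponent n) R) :=
  Algebra.adjoin R
    ({f | f.support ⊆ (cone n : Set (Exponent n))} ∪
      {f | ∃ (k : Fin n) (e : ℤ), (e = 1 ∨ e = -1) ∧
        f = HahnSeries.single (toLex (Pi.single k e)) 1})

variable {R}

theorem single_mem_hatRing (n : ℕ) (v : Fin n → ℤ) :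
    HahnSeries.single (toLex v) (1 : R) ∈ hatRing R n := by
  have hadd : ∀ v w : Fin n → ℤ, HahnSeries.single (toLex v) (1 : R) ∈ hatRing R n →
      HahnSeries.single (toLex w) (1 : R) ∈ hatRing R n →
      HahnSeries.single (toLex (v + w)) (1 : R) ∈ hatRing R n := by
    intro v w hv hw
    have := mul_mem hv hw
    rwa [HahnSeries.single_mul_single, one_mul, ← toLex_add] at this
  have h0 : HahnSeries.single (toLex (0 : Fin n → ℤ)) (1 : R) ∈ hatRing R n :=
    one_mem (hatRing R n)
  have hk : ∀ (k : Fin n) (e : ℤ),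
      HahnSeries.single (toLex (Pi.single k e : Fin n → ℤ)) (1 : R) ∈ hatRing R n := by
    intro k e
    induction e using Int.induction_on with
    | zero => simp
    | succ m ih =>
      rw [Pi.single_add]
      exact hadd _ _ ih (Algebra.subset_adjoin (Or.inr ⟨k, 1, Or.inl rfl, rfl⟩))
    | pred m ih =>
      rw [sub_eq_add_neg, Pi.single_add]
      exact hadd _ _ ih (Algebra.subset_adjoin (Or.inr ⟨k, -1, Or.inr rfl, rfl⟩))
  rw [← Finset.univ_sum_single v]
  exact Finset.sum_induction _
    (fun v : Fin n → ℤ => HahnSeries.single (toLex v) (1 : R) ∈ hatRing R n)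
    hadd h0 (fun k _ => hk k _)

/-- The inclusion of the Laurent polynomials `R[z^{±1}]` into the completed ring. -/
def laurentToHat (R : Type) [CommRing R] (n : ℕ) : Laurent R n →ₐ[R] hatRing R n :=
  AddMonoidAlgebra.lift R (hatRing R n) (Fin n → ℤ)
    { toFun := fun v => ⟨HahnSeries.single (toLex v.toAdd) 1, single_mem_hatRing n _⟩
      map_one' := rfl
      map_mul' := fun v w => Subtype.ext (by
        simp [HahnSeries.single_mul_single]) }

instance (n : ℕ) : Algebra (Laurent R n) (hatRing R n) := (laurentToHat R n).toRingHom.toAlgebra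

end General

/-- `ℱ_{n,l}`, over `K = ℂ(q)`. -/
def F (n l : ℕ) : Submodule (Laurent K n) (MvPolynomial (Fin l) (Laurent K n)) :=
  functionSpace qK n l

/-- The inclusion `A[z^{±1}] → K[z^{±1}]`. -/
def laurentAtoK (n : ℕ) : Laurent A n →+* Laurent K n :=
  AddMonoidAlgebra.mapRingHom (Fin n → ℤ) AtoK

/-- `ℱ_{A,n,l} = ℱ_{n,l} ∩ A[z^{±1}][X_1, …, X_l]`, as an `A[z^{±1}]`-module. -/
def FA (n l : ℕ) : Submodule (Laurent A n) (MvPolynomial (Fin l) (Laurent A n)) where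
  carrier := {P | MvPolynomial.map (laurentAtoK n) P ∈ F n l}
  zero_mem' := by simp
  add_mem' := by
    intro P Q hP hQ
    simpa using add_mem hP hQ
  smul_mem' := by
    intro c P hP
    have := (F n l).smul_mem (laurentAtoK n c) hP
    simpa [MvPolynomial.smul_eq_C_mul] using this

/-- `Â_n = A[[z_1/z_2, …, z_{n-1}/z_n]][z_1^{±1}, …, z_n^{±1}]`. -/
abbrev Ahat (n : ℕ) : Type := hatRing A n

/-- The completion of `ℱ_{A,n,l}`: its base change from `A[z^{±1}]` to `Â_n`. -/
abbrev FAhat (n l : ℕ) : Type := Ahat n ⊗[Laurent A n] FA n l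

/-- The fraction field of `A[z^{±1}][X_1, …, X_l]`. -/
abbrev RatFn (n l : ℕ) : Type := FractionRing (MvPolynomial (Fin l) (Laurent A n))

/-- `X_a` as a rational function. -/
def ratX (n l : ℕ) (a : Fin l) : RatFn n l :=
  algebraMap (MvPolynomial (Fin l) (Laurent A n)) (RatFn n l) (MvPolynomial.X a)

/-- An element of `A[z^{±1}]` as a rational function. -/
def ratC (n l : ℕ) (c : Laurent A n) : RatFn n l :=
  algebraMap (MvPolynomial (Fin l) (Laurent A n)) (RatFn n l) (MvPolynomial.C c)

/-- `G_m(x) = q^{m-n} ∏_{k<m} (1 - q⁻² z_k x) ∏_{k>m} (1 - z_k x)`; the index `m : Fin n` stands for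
`m + 1` in `1, …, n`. -/
def G (n l : ℕ) (m : Fin n) (x : RatFn n l) : RatFn n l :=
  ratC n l (qpow qA n (((m.val : ℤ) + 1) - n)) *
    (∏ k ∈ Finset.univ.filter (fun k : Fin n => k < m),
      (1 - ratC n l (qpow qA n (-2) * zpowVar A n k 1) * x)) *
    (∏ k ∈ Finset.univ.filter (fun k : Fin n => m < k),
      (1 - ratC n l (zpowVar A n k 1) * x))

/-- The right-hand side of the definition of `w_M` for `M = {m_1 < ⋯ < m_l}`: the sum over
`σ ∈ 𝔖_l` of
`G_{m_1}(X_{σ(1)}) ⋯ G_{m_l}(X_{σ(l)}) ∏_{k<k'} (q⁻¹ X_{σ(k)} - q X_{σ(k')}) / (X_{σ(k)} - X_{σ(k')})`.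
-/
def wFormula (n l : ℕ) (M : {M : Finset (Fin n) // M.card = l}) : RatFn n l :=
  ∑ σ : Equiv.Perm (Fin l),
    (∏ a : Fin l, G n l (M.1.orderEmbOfFin M.2 a) (ratX n l (σ a))) *
    ∏ p ∈ (Finset.univ : Finset (Fin l × Fin l)).filter (fun p => p.1 < p.2),
      (ratC n l (qpow qA n (-1)) * ratX n l (σ p.1) - ratC n l (qpow qA n 1) * ratX n l (σ p.2)) /
        (ratX n l (σ p.1) - ratX n l (σ p.2))

end FunctionalModel

end

/-! Elements of `FA n l` are tested by their values at the points `X_a = z_{m_a}⁻¹`, one point for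
each `l`-subset `M`. These values determine the element: with some variables fixed at distinct
`z_k⁻¹`, the polynomial in one further variable has degree less than `n`. It vanishes at `q² z_k⁻¹`
for each used `k` by the wheel condition, and at `z_k⁻¹` for each unused `k` by induction
(`eq_zero_of_eval_injective_eq_zero`).

The family `w_N` is triangular for these tests. Since `G_m(z_k⁻¹) = 0` for `k > m`, a nonzero
summand of `w_N` at the point of `M` matches each element of `N` with an element of `M` that is no
larger. Hence, off the diagonal, the value vanishes unless the sum of the elements of `M` is
strictly smaller than that of `N` (`eval_eq_zero_of_weight_le`). On the diagonal only the identity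
permutation contributes, and the value is, up to a Vandermonde factor, a product of monomials and
terms `1 - c z_i/z_j` with `i < j`, which geometric series invert in `Ahat n`
(`isUnit_algebraMap_det`). Cramer's rule then turns separation and an invertible determinant into a
basis (`exists_basis_baseChange`).

Membership of `w_M` in `FA n l` comes from writing it as an alternating numerator `wNumer` over the
Vandermonde product. Divisibility, symmetry, degree bounds and the wheel condition are all read off
from `w * vdm = wNumer`. -/

noncomputable section

namespace FunctionalModel

open MvPolynomial

/-! ### Alternating polynomials and the Vandermonde product -/

section Alternating

variable {D : Type*} [CommRing D]

/-- Modulo `X i - X j`, the substitution `X i ↦ X j` is the identity on generators. Divisibility by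
`X i - X j` thus becomes a vanishing condition, from which primality follows over a domain. -/
theorem X_sub_X_dvd_sub_rename {σ : Type*} [DecidableEq σ] (i j : σ) (f : MvPolynomial σ D) :
    (X i - X j : MvPolynomial σ D) ∣ f - rename (Function.update id i j) f := by
  rw [← Ideal.mem_span_singleton, ← Ideal.Quotient.eq]
  have h : (Ideal.Quotient.mkₐ D (Ideal.span {(X i - X j : MvPolynomial σ D)})) =
      (Ideal.Quotient.mkₐ D (Ideal.span {(X i - X j : MvPolynomial σ D)})).comp
        (rename (Function.update id i j)) := by
    ext k
    simp only [AlgHom.comp_apply, rename_X]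
    by_cases hk : k = i
    · subst hk
      simp only [Function.update_self]
      exact Ideal.Quotient.eq.2 (Ideal.mem_span_singleton_self _)
    · simp [Function.update_of_ne hk]
  exact DFunLike.congr_fun h f

theorem X_sub_X_dvd_iff {σ : Type*} [DecidableEq σ] (i j : σ) (f : MvPolynomial σ D) :
    (X i - X j : MvPolynomial σ D) ∣ f ↔ rename (Function.update id i j) f = 0 := by
  constructor
  · rintro ⟨g, rfl⟩
    have : Function.update (id : σ → σ) i j j = j := by
      by_cases h : j = i
      · subst h; simp
      · simp [Function.update_of_ne h]
    simp [this]
  · intro h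
    simpa [h] using X_sub_X_dvd_sub_rename i j f

theorem X_sub_X_ne_zero [Nontrivial D] {σ : Type*} {i j : σ} (h : i ≠ j) :
    (X i - X j : MvPolynomial σ D) ≠ 0 :=
  sub_ne_zero.2 fun e => h (X_injective e)

theorem prime_X_sub_X [IsDomain D] {σ : Type*} {i j : σ} (h : i ≠ j) :
    Prime (X i - X j : MvPolynomial σ D) := by
  classical
  refine ⟨X_sub_X_ne_zero h, fun hu => ?_, fun a b hab => ?_⟩
  · have h0 := (X_sub_X_dvd_iff (D := D) i j 1).1 hu.dvd
    simp at h0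
  · simp only [X_sub_X_dvd_iff, map_mul, mul_eq_zero] at hab ⊢
    exact hab

/-- Each new prime divides none of the earlier ones, so it must divide the remaining cofactor. No
unique factorization in `B` is needed. -/
theorem prod_dvd_of_prime {B ι : Type*} [CommRing B] [IsDomain B] (s : Finset ι) (p : ι → B)
    (hp : ∀ i ∈ s, Prime (p i)) (hne : ∀ i ∈ s, ∀ j ∈ s, i ≠ j → ¬ p i ∣ p j) (f : B)
    (hf : ∀ i ∈ s, p i ∣ f) : ∏ i ∈ s, p i ∣ f := by
  classical
  induction s using Finset.induction_on with
  | empty => simp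
  | insert i s hi ih =>
    obtain ⟨c, hc⟩ := ih (fun k hk => hp k (Finset.mem_insert_of_mem hk))
      (fun k hk k' hk' => hne k (Finset.mem_insert_of_mem hk) k' (Finset.mem_insert_of_mem hk'))
      (fun k hk => hf k (Finset.mem_insert_of_mem hk))
    have hpi := hp i (Finset.mem_insert_self _ _)
    have hdvd : p i ∣ (∏ k ∈ s, p k) * c := hc ▸ hf i (Finset.mem_insert_self _ _)
    rcases hpi.dvd_or_dvd hdvd with h | h
    · obtain ⟨k, hk, hk'⟩ := (hpi.dvd_finsetProd_iff _).1 h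
      exact absurd hk' (hne i (Finset.mem_insert_self _ _) k (Finset.mem_insert_of_mem hk)
        (fun e => hi (e ▸ hk)))
    · rw [Finset.prod_insert hi, hc, mul_comm (p i)]
      exact mul_dvd_mul_left _ h

/-- The pairs `k < k'` of indices. -/
abbrev ltPairs (l : ℕ) : Finset (Fin l × Fin l) :=
  (Finset.univ : Finset (Fin l × Fin l)).filter (fun p => p.1 < p.2)

theorem prod_ltPairs {B : Type*} [CommMonoid B] {l : ℕ} (f : Fin l → Fin l → B) :
    ∏ p ∈ ltPairs l, f p.1 p.2 = ∏ i, ∏ j ∈ Finset.Ioi i, f i j := by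
  rw [Finset.prod_filter, Fintype.prod_prod_type]
  refine Finset.prod_congr rfl fun i _ => ?_
  rw [← Finset.prod_filter]
  congr 1
  ext j
  simp

variable (D) in
/-- The Vandermonde product `∏_{k<k'} (X_k - X_k')`. -/
def vdm (l : ℕ) : MvPolynomial (Fin l) D := ∏ p ∈ ltPairs l, (X p.1 - X p.2)

theorem vdm_ne_zero [IsDomain D] (l : ℕ) : vdm D l ≠ 0 := by
  refine Finset.prod_ne_zero_iff.2 fun p hp => X_sub_X_ne_zero ?_
  exact (Finset.mem_filter.1 hp).2.ne

theorem prod_ltPairs_perm {B : Type*} [CommRing B] {l : ℕ} (v : Fin l → B)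
    (σ : Equiv.Perm (Fin l)) :
    ∏ p ∈ ltPairs l, (v (σ p.1) - v (σ p.2)) =
      ((Equiv.Perm.sign σ : ℤ) : B) * ∏ p ∈ ltPairs l, (v p.1 - v p.2) := by
  rw [prod_ltPairs (fun i j => v (σ i) - v (σ j)), prod_ltPairs (fun i j => v i - v j)]
  exact Equiv.Perm.prod_Ioi_comp_eq_sign_mul_prod σ (f := fun i j => v i - v j)
    fun i j => by ring

theorem rename_vdm {l : ℕ} (σ : Equiv.Perm (Fin l)) :
    rename σ (vdm D l) = ((Equiv.Perm.sign σ : ℤ) : MvPolynomial (Fin l) D) * vdm D l := by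
  simp only [vdm, map_prod, map_sub, rename_X]
  exact prod_ltPairs_perm (B := MvPolynomial (Fin l) D) X σ

/-- Putting `X i = X j` in an alternating `f` gives `f = -f`, hence `0` because `2 ≠ 0`. So every `X
i - X j` divides `f`, and these primes do not divide one another. -/
theorem vdm_dvd_of_alternating [IsDomain D] (h2 : (2 : D) ≠ 0) {l : ℕ}
    (f : MvPolynomial (Fin l) D)
    (hf : ∀ i j : Fin l, i ≠ j → rename (Equiv.swap i j) f = -f) : vdm D l ∣ f := by
  refine prod_dvd_of_prime _ _ (fun p hp => prime_X_sub_X (Finset.mem_filter.1 hp).2.ne) ?_ f ?_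
  · rintro ⟨i, j⟩ hij ⟨i', j'⟩ hij' hne hdvd
    simp only [Finset.mem_filter, Finset.mem_univ, true_and] at hij hij'
    rw [X_sub_X_dvd_iff] at hdvd
    simp only [map_sub, rename_X, sub_eq_zero] at hdvd
    have h := X_injective hdvd
    simp only [Function.update_apply, id] at h
    apply hne
    split_ifs at h <;> grind
  · rintro ⟨i, j⟩ hij
    simp only [Finset.mem_filter, Finset.mem_univ, true_and] at hij
    rw [X_sub_X_dvd_iff]
    have h1 : rename (Function.update id i j) (rename (Equiv.swap i j) f) =
        rename (Function.update id i j) f := by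
      rw [rename_rename]
      congr 2
      ext k
      simp only [Function.comp, Function.update_apply, id, Equiv.swap_apply_def]
      split_ifs <;> simp_all
    rw [hf i j hij.ne, map_neg, neg_eq_iff_add_eq_zero, ← two_mul, mul_eq_zero] at h1
    refine h1.resolve_left fun h => h2 ?_
    rwa [← map_ofNat (C : D →+* MvPolynomial (Fin l) D), C_eq_zero] at h

/-- Permuting variables changes the Vandermonde product only by a sign. This lets degrees be
compared without computing the actual value `l - 1`. -/
theorem degreeOf_vdm_perm [IsDomain D] {l : ℕ} (σ : Equiv.Perm (Fin l)) (a : Fin l) :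
    degreeOf (σ a) (vdm D l) = degreeOf a (vdm D l) := by
  rw [← degreeOf_rename_of_injective σ.injective a, rename_vdm]
  rcases Int.units_eq_one_or (Equiv.Perm.sign σ) with h | h <;> simp [h, degreeOf_neg]

theorem degreeOf_linear_le_X_sub_X [IsDomain D] {σ : Type*} {i j : σ} (hij : i ≠ j)
    (a : σ) (c d : D) :
    degreeOf a (C c * X i - C d * X j : MvPolynomial σ D) ≤
      degreeOf a (X i - X j : MvPolynomial σ D) := by
  classical
  have h1 : degreeOf a (C c * X i - C d * X j : MvPolynomial σ D) ≤
      if a = i ∨ a = j then 1 else 0 := by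
    refine (degreeOf_sub_le _ _ _).trans (max_le ?_ ?_) <;>
    · refine (degreeOf_C_mul_le _ _ _).trans ?_
      rw [degreeOf_X]
      split_ifs <;> simp_all
  refine h1.trans ?_
  split_ifs with h
  · rcases h with rfl | rfl
    · rw [sub_eq_add_neg, degreeOf_add_eq_of_degreeOf_lt] <;>
        simp [degreeOf_neg, degreeOf_X_of_ne hij]
    · rw [sub_eq_add_neg, add_comm, degreeOf_add_eq_of_degreeOf_lt] <;>
        simp [degreeOf_neg, degreeOf_X_of_ne hij.symm]
  · simp

theorem degreeOf_prod_linear_le_vdm [IsDomain D] {l : ℕ} (a : Fin l) (c d : D) :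
    degreeOf a (∏ p ∈ ltPairs l, (C c * X p.1 - C d * X p.2 : MvPolynomial (Fin l) D)) ≤
      degreeOf a (vdm D l) := by
  have hne : ∀ p ∈ ltPairs l, p.1 ≠ p.2 := fun p hp => (Finset.mem_filter.1 hp).2.ne
  have h := degreeOf_prod_eq (n := a) (ltPairs l)
    (fun p => (X p.1 - X p.2 : MvPolynomial (Fin l) D)) fun p hp => X_sub_X_ne_zero (hne p hp)
  rw [vdm, h]
  refine (degreeOf_prod_le _ _ _).trans (Finset.sum_le_sum fun p hp => ?_)
  exact degreeOf_linear_le_X_sub_X (hne p hp) _ _ _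

end Alternating

/-! ### Separation by values at distinct points -/

section Vanishing

variable {D : Type*} [CommRing D]

theorem eval_comp_perm {σ : Type*} {P : MvPolynomial σ D} (hP : P.IsSymmetric) (v : σ → D)
    (e : Equiv.Perm σ) : eval (v ∘ e) P = eval v P := by
  rw [← eval_rename, hP e]

theorem natDegree_aeval_update_le {σ : Type*} [DecidableEq σ] (v : σ → D)
    (b : σ) (P : MvPolynomial σ D) :
    (aeval (Function.update (fun a => Polynomial.C (v a)) b Polynomial.X) P).natDegree ≤
      degreeOf b P := by
  rw [aeval_def, eval₂_eq]
  refine Polynomial.natDegree_sum_le_of_forall_le _ _ fun s hs => ?_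
  rw [← Polynomial.C_eq_algebraMap]
  refine (Polynomial.natDegree_C_mul_le _ _).trans ?_
  refine (Polynomial.natDegree_prod_le _ _).trans ?_
  refine le_trans ?_ (le_degreeOf_of_mem_support b hs)
  calc _ ≤ ∑ i ∈ s.support, if i = b then s b else 0 := by
        refine Finset.sum_le_sum fun i _ => ?_
        by_cases h : i = b
        · subst h
          simpa using Polynomial.natDegree_X_pow_le (R := D) (s i)
        · simp only [Function.update_of_ne h, h, if_false, ← Polynomial.C_pow,
            Polynomial.natDegree_C, le_refl]
    _ ≤ s b := by
        rw [Finset.sum_ite_eq']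
        split_ifs <;> simp

theorem eval_aeval_update {σ : Type*} [DecidableEq σ] (v : σ → D)
    (b : σ) (P : MvPolynomial σ D) (y : D) :
    (aeval (Function.update (fun a => Polynomial.C (v a)) b Polynomial.X) P).eval y =
      eval (Function.update v b y) P := by
  induction P using MvPolynomial.induction_on with
  | C a => simp
  | add p q hp hq => simp [hp, hq]
  | mul_X p i hp =>
    rw [map_mul, Polynomial.eval_mul, hp, map_mul, aeval_X, eval_X]
    by_cases h : i = b
    · subst h; simp
    · simp [h]

/-- A polynomial of degree less than `n` in each variable, which vanishes whenever two of
its arguments are `x_k` and `t x_k`, is determined by its values at the `l`-tuples of distinct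
`x_k`. -/
theorem eq_zero_of_eval_injective_eq_zero [IsDomain D] [Infinite D] {n l : ℕ} (x : Fin n → D)
    (t : D) (hx : Function.Injective x) (htx : Function.Injective fun k => t * x k)
    (hne : ∀ i j, i ≠ j → t * x i ≠ x j) (P : MvPolynomial (Fin l) D)
    (hdeg : ∀ a, P.degreeOf a < n)
    (hwheel : ∀ (v : Fin l → D) (a b : Fin l) (k : Fin n), a ≠ b → v a = x k → v b = t * x k →
      eval v P = 0)
    (heval : ∀ f : Fin l → Fin n, Function.Injective f → eval (x ∘ f) P = 0) : P = 0 := by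
  classical
  -- `T` is the set of coordinates already pinned to distinct points `x k`; the induction is on the
  -- number of free coordinates.
  have key : ∀ (m : ℕ) (T : Finset (Fin l)), Tᶜ.card = m → ∀ (v : Fin l → D) (f : Fin l → Fin n),
      Set.InjOn f T → (∀ a ∈ T, v a = x (f a)) → eval v P = 0 := by
    intro m
    induction m with
    | zero =>
      intro T hT v f hf hv
      rw [Finset.card_eq_zero, Finset.compl_eq_empty_iff] at hT
      subst hT
      have : v = x ∘ f := funext fun a => hv a (Finset.mem_univ _)
      rw [this]
      exact heval f (by simpa [Set.injOn_univ] using hf)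
    | succ m ih =>
      intro T hT v f hf hv
      obtain ⟨b, hb⟩ : Tᶜ.Nonempty := Finset.card_pos.1 (by omega)
      have hbT : b ∉ T := Finset.mem_compl.1 hb
      let p : Polynomial D :=
        aeval (Function.update (fun a => Polynomial.C (v a)) b Polynomial.X) P
      have hp : p = 0 := by
        -- These are `n` roots: `t * x k` for a used index `k` (wheel condition), `x k` for an
        -- unused one (induction). A root of each kind never shares its index, so `hne` for distinct
        -- indices suffices to separate them.
        refine Polynomial.eq_zero_of_natDegree_lt_card_of_eval_eq_zero p
          (f := fun k : Fin n => if k ∈ T.image f then t * x k else x k) ?_ ?_ ?_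
        · intro k k' h
          by_contra hkk
          simp only at h
          split_ifs at h with h1 h2 h2
          · exact hkk (htx h)
          · exact hne _ _ hkk h
          · exact hne _ _ (Ne.symm hkk) h.symm
          · exact hkk (hx h)
        · intro k
          rw [eval_aeval_update]
          split_ifs with hk
          · obtain ⟨a, ha, rfl⟩ := Finset.mem_image.1 hk
            have hab : a ≠ b := fun e => hbT (e ▸ ha)
            refine hwheel _ a b (f a) hab ?_ (by simp)
            rw [Function.update_of_ne hab, hv a ha]
          · refine ih (insert b T) ?_ _ (Function.update f b k) ?_ ?_
            · rw [Finset.compl_insert, Finset.card_erase_of_mem hb]; omega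
            · rw [Finset.coe_insert, Set.injOn_insert (by simpa using hbT)]
              have hEq : Set.EqOn (Function.update f b k) f T := fun a ha =>
                Function.update_of_ne (fun e => hbT (by rw [← e]; exact ha)) _ _
              refine ⟨hf.congr hEq.symm, ?_⟩
              rw [hEq.image_eq, Function.update_self]
              simpa using hk
            · intro a ha
              by_cases hab : a = b
              · subst hab; simp
              · rw [Function.update_of_ne hab, Function.update_of_ne hab]
                exact hv a ((Finset.mem_insert.1 ha).resolve_left hab)
        · rw [Fintype.card_fin]
          exact (natDegree_aeval_update_le v b P).trans_lt (hdeg b)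
      have := eval_aeval_update v b P (v b)
      rw [show aeval _ P = p from rfl, hp, Function.update_eq_self, Polynomial.eval_zero] at this
      exact this.symm
  refine MvPolynomial.funext fun v => ?_
  rw [map_zero]
  -- `key` asks for some `f` even when `T` is empty. If there is none, then `n = 0` while a variable
  -- exists, against `hdeg`.
  by_cases h : Nonempty (Fin l → Fin n)
  · exact key _ ∅ rfl v h.some (by simp) (by simp)
  · exfalso
    rw [not_nonempty_iff, isEmpty_pi] at h
    obtain ⟨a, ha⟩ := h
    have := hdeg a
    exact ha.elim ⟨0, by omega⟩

end Vanishing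

end FunctionalModel

end

noncomputable section

namespace FunctionalModel

/-! ### Triangular determinants and bases after base change -/

section LinearAlgebra

/-- A permutation with nonzero contribution never raises `f`, and strictly lowers it wherever it
moves a point. Since it preserves the total of `f`, it is the identity. No linear order on `ι` has
to be chosen. -/
theorem det_eq_prod_diag_of_weight {R ι : Type*} [CommRing R] [Fintype ι] [DecidableEq ι]
    (E : Matrix ι ι R) (f : ι → ℕ) (hE : ∀ i j, i ≠ j → f j ≤ f i → E i j = 0) :
    E.det = ∏ i, E i i := by
  rw [Matrix.det_apply, Finset.sum_eq_single 1]
  · simp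
  · intro σ _ hσ
    obtain ⟨i, hi⟩ : ∃ i, E (σ i) i = 0 := by
      by_contra! h
      have hle : ∀ i, f (σ i) ≤ f i := fun i => by
        by_cases hi : σ i = i
        · rw [hi]
        · by_contra! hlt
          exact h i (hE _ _ hi hlt.le)
      obtain ⟨i, hi⟩ : ∃ i, σ i ≠ i := by
        by_contra! h'
        exact hσ (Equiv.ext h')
      have hlt : f (σ i) < f i := by
        by_contra! hge
        exact h i (hE _ _ hi hge)
      exact (Finset.sum_lt_sum (fun i _ => hle i) ⟨i, Finset.mem_univ _, hlt⟩).ne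
        (Equiv.sum_comp σ f)
    rw [Finset.prod_eq_zero (f := fun i => E (σ i) i) (Finset.mem_univ i) hi, smul_zero]
  · intro h
    exact absurd (Finset.mem_univ _) h

/-- A family `w` which is dual, up to a matrix invertible over `S`, to a separating family of
functionals becomes a basis after base change to `S`. -/
theorem exists_basis_baseChange {R S V ι : Type*} [CommRing R] [CommRing S] [Algebra R S]
    [AddCommGroup V] [Module R V] [Fintype ι] [DecidableEq ι] (e : ι → V →ₗ[R] R) (w : ι → V)
    (hsep : ∀ v, (∀ i, e i v = 0) → v = 0)
    (hdet : IsUnit (algebraMap R S (Matrix.det (Matrix.of fun i j => e i (w j))))) :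
    ∃ b : Module.Basis ι S (S ⊗[R] V), ∀ i, b i = (1 : S) ⊗ₜ[R] w i := by
  set E : Matrix ι ι R := Matrix.of fun i j => e i (w j) with hE
  -- The base-changed functionals turn a relation into `E c = 0`; the adjugate then gives `det E • c
  -- = 0`.
  have hli : LinearIndependent S fun i => (1 : S) ⊗ₜ[R] w i := by
    rw [Fintype.linearIndependent_iff]
    intro c hc
    have hcol : ∀ i, ∑ j, algebraMap R S (E i j) * c j = 0 := by
      intro i
      have h := congrArg
        ((TensorProduct.AlgebraTensorModule.rid R S S).toLinearMap ∘ₗ (e i).baseChange S) hc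
      rw [map_sum, map_zero] at h
      rw [← h]
      refine Finset.sum_congr rfl fun j _ => ?_
      simp [hE, TensorProduct.smul_tmul', Algebra.smul_def]
    have hmv : (E.map (algebraMap R S)).mulVec c = 0 := funext fun i => hcol i
    have hdet' : IsUnit (E.map (algebraMap R S)).det := by
      rw [← RingHom.mapMatrix_apply, ← RingHom.map_det]
      exact hdet
    have h2 := congrArg (Matrix.mulVec (E.map (algebraMap R S)).adjugate) hmv
    rw [Matrix.mulVec_mulVec, Matrix.adjugate_mul, Matrix.mulVec_zero, Matrix.smul_mulVec,
      Matrix.one_mulVec] at h2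
    intro i
    have := congrFun h2 i
    simpa [hdet'.mul_right_eq_zero] using this
  -- Cramer's rule holds already over `R`, since both sides have equal values under all `e i`.
  -- Separation is therefore never needed over `S`.
  have hcramer : ∀ v, E.det • v = ∑ j, (E.adjugate.mulVec fun i => e i v) j • w j := by
    intro v
    rw [← sub_eq_zero]
    refine hsep _ fun i => ?_
    rw [map_sub, map_smul, map_sum, sub_eq_zero]
    simp only [map_smul, smul_eq_mul]
    have h := congrFun (Matrix.mulVec_mulVec (fun i => e i v) E E.adjugate) i
    rw [Matrix.mul_adjugate, Matrix.smul_mulVec, Matrix.one_mulVec] at h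
    simp only [Pi.smul_apply, smul_eq_mul] at h
    rw [← h]
    simp only [Matrix.mulVec, dotProduct, hE, Matrix.of_apply]
    exact Finset.sum_congr rfl fun j _ => mul_comm _ _
  have hspan : ⊤ ≤ Submodule.span S (Set.range fun i => (1 : S) ⊗ₜ[R] w i) := by
    have hone : ∀ v : V, (1 : S) ⊗ₜ[R] v ∈
        Submodule.span S (Set.range fun i => (1 : S) ⊗ₜ[R] w i) := by
      intro v
      have h : algebraMap R S E.det • (1 : S) ⊗ₜ[R] v ∈
          Submodule.span S (Set.range fun i => (1 : S) ⊗ₜ[R] w i) := by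
        rw [algebraMap_smul, ← TensorProduct.tmul_smul, hcramer, TensorProduct.tmul_sum]
        refine Submodule.sum_mem _ fun j _ => ?_
        rw [TensorProduct.tmul_smul, ← algebraMap_smul S]
        exact Submodule.smul_mem _ _ (Submodule.subset_span ⟨j, rfl⟩)
      obtain ⟨u, hu⟩ := hdet
      rw [← hu] at h
      have := Submodule.smul_mem _ ((u⁻¹ : Sˣ) : S) h
      rwa [smul_smul, Units.inv_mul, one_smul] at this
    intro t _
    induction t using TensorProduct.induction_on with
    | zero => exact Submodule.zero_mem _
    | tmul s v =>
      rw [← mul_one s, ← smul_eq_mul, ← TensorProduct.smul_tmul']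
      exact Submodule.smul_mem _ _ (hone v)
    | add a b ha hb => exact Submodule.add_mem _ (ha trivial) (hb trivial)
  exact ⟨Module.Basis.mk hli hspan, fun i => Module.Basis.mk_apply hli hspan i⟩

end LinearAlgebra

/-! ### The numerators of the weight functions, their vanishing and their values -/

section Weight

open MvPolynomial

variable {D : Type*} [CommRing D] {n l : ℕ} (q : Dˣ) (z : Fin n → Dˣ)

/-- `G_m(X)` as a polynomial. -/
def gPoly (m : Fin n) : Polynomial D :=
  Polynomial.C ((q ^ (((m.val : ℤ) + 1) - n) : Dˣ) : D) *
    (∏ k ∈ Finset.univ.filter (fun k : Fin n => k < m),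
      (1 - Polynomial.C (((q ^ (-2 : ℤ) : Dˣ) : D) * z k) * Polynomial.X)) *
    (∏ k ∈ Finset.univ.filter (fun k : Fin n => m < k),
      (1 - Polynomial.C (z k : D) * Polynomial.X))

theorem natDegree_gPoly_le (m : Fin n) : (gPoly q z m).natDegree ≤ n - 1 := by
  have h1 : ∀ c : D, (1 - Polynomial.C c * Polynomial.X : Polynomial D).natDegree ≤ 1 :=
    fun c => (Polynomial.natDegree_sub_le _ _).trans
      (by simpa using Polynomial.natDegree_C_mul_le c Polynomial.X |>.trans Polynomial.natDegree_X_le)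
  have h2 : ∀ (s : Finset (Fin n)) (c : Fin n → D),
      (∏ k ∈ s, (1 - Polynomial.C (c k) * Polynomial.X)).natDegree ≤ s.card := fun s c =>
    (Polynomial.natDegree_prod_le _ _).trans
      ((Finset.sum_le_sum fun k _ => h1 (c k)).trans (by simp))
  have hcard : (Finset.univ.filter (fun k : Fin n => k < m)).card +
      (Finset.univ.filter (fun k : Fin n => m < k)).card ≤ n - 1 := by
    rw [← Finset.card_union_of_disjoint]
    · calc _ ≤ (Finset.univ.erase m).card := Finset.card_le_card fun k hk => by
            simp only [Finset.mem_union, Finset.mem_filter, Finset.mem_univ, true_and] at hk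
            exact Finset.mem_erase.2 ⟨by rintro rfl; simp at hk, Finset.mem_univ _⟩
        _ = n - 1 := by simp
    · rw [Finset.disjoint_left]
      intro k hk hk'
      simp only [Finset.mem_filter] at hk hk'
      exact lt_asymm hk.2 hk'.2
  rw [gPoly, mul_assoc]
  refine (Polynomial.natDegree_C_mul_le _ _).trans ((Polynomial.natDegree_mul_le).trans ?_)
  exact (Nat.add_le_add (h2 _ _) (h2 _ _)).trans hcard

theorem aeval_gPoly {B : Type*} [CommRing B] [Algebra D B] (m : Fin n) (b : B) :
    Polynomial.aeval b (gPoly q z m) =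
      algebraMap D B ((q ^ (((m.val : ℤ) + 1) - n) : Dˣ) : D) *
      (∏ k ∈ Finset.univ.filter (fun k : Fin n => k < m),
        (1 - algebraMap D B (((q ^ (-2 : ℤ) : Dˣ) : D) * z k) * b)) *
      (∏ k ∈ Finset.univ.filter (fun k : Fin n => m < k),
        (1 - algebraMap D B (z k : D) * b)) := by
  simp only [gPoly, map_mul, map_prod, map_sub, map_one, Polynomial.aeval_C, Polynomial.aeval_X]

theorem eval_gPoly_inv_of_lt {m k : Fin n} (h : m < k) :
    (gPoly q z m).eval ((z k)⁻¹ : Dˣ).val = 0 := by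
  rw [← Polynomial.coe_aeval_eq_eval, aeval_gPoly]
  refine mul_eq_zero_of_right _ (Finset.prod_eq_zero (i := k) (by simpa using h) ?_)
  simp

theorem eval_gPoly_sq_mul_inv_of_lt {m k : Fin n} (h : k < m) :
    (gPoly q z m).eval ((q ^ (2 : ℤ) * (z k)⁻¹ : Dˣ)).val = 0 := by
  rw [← Polynomial.coe_aeval_eq_eval, aeval_gPoly]
  refine mul_eq_zero_of_left
    (mul_eq_zero_of_right _ (Finset.prod_eq_zero (i := k) (by simpa using h) ?_)) _
  rw [Algebra.algebraMap_self_apply, ← Units.val_mul, ← Units.val_mul]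
  have : q ^ (-2 : ℤ) * z k * (q ^ (2 : ℤ) * (z k)⁻¹) = 1 := by
    rw [mul_mul_mul_comm, ← zpow_add]; simp
  rw [this]; simp

/-- The term of `w_M` indexed by the identity, times the Vandermonde product. -/
def wTerm (m : Fin l → Fin n) : MvPolynomial (Fin l) D :=
  (∏ a, Polynomial.aeval (X a : MvPolynomial (Fin l) D) (gPoly q z (m a))) *
    ∏ p ∈ ltPairs l, (C ((q ^ (-1 : ℤ) : Dˣ) : D) * X p.1 - C ((q ^ (1 : ℤ) : Dˣ) : D) * X p.2)

/-- The antisymmetrisation of `wTerm`. -/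
def wNumer (m : Fin l → Fin n) : MvPolynomial (Fin l) D :=
  ∑ σ : Equiv.Perm (Fin l),
    ((Equiv.Perm.sign σ : ℤ) : MvPolynomial (Fin l) D) * rename σ (wTerm q z m)

theorem rename_wNumer (m : Fin l → Fin n) (τ : Equiv.Perm (Fin l)) :
    rename τ (wNumer q z m) =
      ((Equiv.Perm.sign τ : ℤ) : MvPolynomial (Fin l) D) * wNumer q z m := by
  rw [wNumer, map_sum, Finset.mul_sum, ← Equiv.sum_comp (Equiv.mulLeft τ)
    fun σ => ((Equiv.Perm.sign τ : ℤ) : MvPolynomial (Fin l) D) *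
      (((Equiv.Perm.sign σ : ℤ) : MvPolynomial (Fin l) D) * rename σ (wTerm q z m))]
  refine Finset.sum_congr rfl fun σ _ => ?_
  rw [map_mul, map_intCast, rename_rename, ← mul_assoc, ← Int.cast_mul]
  simp only [Equiv.coe_mulLeft, Equiv.Perm.sign_mul, Units.val_mul, Equiv.Perm.coe_mul]
  rw [← mul_assoc, ← Units.val_mul, Int.units_mul_self, Units.val_one, one_mul]

theorem aeval_rename_wTerm {B : Type*} [CommRing B] [Algebra D B] (m : Fin l → Fin n)
    (σ : Equiv.Perm (Fin l)) (v : Fin l → B) :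
    aeval v (rename σ (wTerm q z m)) =
      (∏ a, Polynomial.aeval (v (σ a)) (gPoly q z (m a))) *
        ∏ p ∈ ltPairs l, (algebraMap D B ((q ^ (-1 : ℤ) : Dˣ) : D) * v (σ p.1) -
          algebraMap D B ((q ^ (1 : ℤ) : Dˣ) : D) * v (σ p.2)) := by
  rw [aeval_rename, wTerm]
  simp only [map_mul, map_prod, map_sub, aeval_X, ← Polynomial.aeval_algHom_apply, Function.comp,
    MvPolynomial.algHom_C]

theorem aeval_wNumer {B : Type*} [CommRing B] [Algebra D B] (m : Fin l → Fin n) (v : Fin l → B) :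
    aeval v (wNumer q z m) = ∑ σ : Equiv.Perm (Fin l), ((Equiv.Perm.sign σ : ℤ) : B) *
      ((∏ a, Polynomial.aeval (v (σ a)) (gPoly q z (m a))) *
        ∏ p ∈ ltPairs l, (algebraMap D B ((q ^ (-1 : ℤ) : Dˣ) : D) * v (σ p.1) -
          algebraMap D B ((q ^ (1 : ℤ) : Dˣ) : D) * v (σ p.2))) := by
  rw [wNumer, map_sum]
  exact Finset.sum_congr rfl fun σ _ => by rw [map_mul, map_intCast, aeval_rename_wTerm]

theorem degreeOf_aeval_X_le (a b : Fin l) (g : Polynomial D) :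
    degreeOf a (Polynomial.aeval (X b : MvPolynomial (Fin l) D) g) ≤
      if a = b then g.natDegree else 0 := by
  rw [Polynomial.aeval_eq_sum_range]
  refine (degreeOf_sum_le _ _ _).trans (Finset.sup_le fun i hi => ?_)
  rw [smul_eq_C_mul]
  refine (degreeOf_C_mul_le _ _ _).trans ?_
  split_ifs with h
  · subst h
    refine (degreeOf_pow_le _ _ _).trans ?_
    rcases subsingleton_or_nontrivial D with hD | hD
    · simp [Subsingleton.elim (X a : MvPolynomial (Fin l) D) 0]
    simpa using Nat.lt_succ_iff.1 (Finset.mem_range.1 hi)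
  · rw [degreeOf_X_pow_of_ne _ h]

theorem degreeOf_wTerm_le [IsDomain D] (m : Fin l → Fin n) (a : Fin l) :
    degreeOf a (wTerm q z m) ≤ n - 1 + degreeOf a (vdm D l) := by
  refine (degreeOf_mul_le _ _ _).trans (Nat.add_le_add ?_ (degreeOf_prod_linear_le_vdm _ _ _))
  refine (degreeOf_prod_le _ _ _).trans
    ((Finset.sum_le_sum fun b _ => degreeOf_aeval_X_le a b _).trans ?_)
  simpa using natDegree_gPoly_le q z (m a)

theorem degreeOf_wNumer_le [IsDomain D] (m : Fin l → Fin n) (a : Fin l) :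
    degreeOf a (wNumer q z m) ≤ n - 1 + degreeOf a (vdm D l) := by
  refine (degreeOf_sum_le _ _ _).trans (Finset.sup_le fun σ _ => ?_)
  obtain ⟨b, rfl⟩ := σ.surjective a
  rw [degreeOf_vdm_perm]
  refine le_trans ?_ (degreeOf_wTerm_le q z m b)
  rw [← degreeOf_rename_of_injective σ.injective b]
  rcases Int.units_eq_one_or (Equiv.Perm.sign σ) with h | h <;> simp [h, degreeOf_neg]

/-- The numerator is alternating by `rename_wNumer`, so the Vandermonde product divides it and `w_M`
is a polynomial. -/
theorem exists_mul_vdm_eq_wNumer [IsDomain D] (h2 : (2 : D) ≠ 0) (m : Fin l → Fin n) :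
    ∃ w, w * vdm D l = wNumer q z m := by
  obtain ⟨w, hw⟩ := vdm_dvd_of_alternating h2 (wNumer q z m) fun i j hij => by
    rw [rename_wNumer, Equiv.Perm.sign_swap hij]; simp
  exact ⟨w, by rw [hw, mul_comm]⟩

variable {q z} {m : Fin l → Fin n} {w : MvPolynomial (Fin l) D}

theorem isSymmetric_of_mul_vdm [IsDomain D] (hw : w * vdm D l = wNumer q z m) :
    w.IsSymmetric := by
  intro σ
  have h := congrArg (rename σ) hw
  rw [map_mul, rename_vdm, rename_wNumer, ← hw, mul_left_comm] at h
  have hs : (((Equiv.Perm.sign σ : ℤˣ) : ℤ) : MvPolynomial (Fin l) D) ≠ 0 := by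
    rcases Int.units_eq_one_or (Equiv.Perm.sign σ) with h | h <;> simp [h]
  exact mul_right_cancel₀ (vdm_ne_zero l) (mul_left_cancel₀ hs h)

theorem degreeOf_le_of_mul_vdm [IsDomain D] (hw : w * vdm D l = wNumer q z m) (a : Fin l) :
    degreeOf a w ≤ n - 1 := by
  by_cases h0 : w = 0
  · simp [h0]
  have h := degreeOf_wNumer_le q z m a
  rw [← hw, degreeOf_mul_eq h0 (vdm_ne_zero l)] at h
  omega

/-- Every summand of the numerator vanishes, while injectivity of `v` keeps the Vandermonde product
nonzero. A general `B` allows the remaining variables to stay indeterminate. -/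
theorem aeval_eq_zero_of_mul_vdm {B : Type*} [CommRing B] [IsDomain B] [Algebra D B]
    (hm : StrictMono m) (hw : w * vdm D l = wNumer q z m)
    {v : Fin l → B} (hv : Function.Injective v) {a b : Fin l} (hab : a ≠ b) (k : Fin n)
    (ha : v a = algebraMap D B ((z k)⁻¹ : Dˣ).val)
    (hb : v b = algebraMap D B (q ^ (2 : ℤ) * (z k)⁻¹ : Dˣ).val) : aeval v w = 0 := by
  have h := congrArg (aeval v) hw
  rw [map_mul, aeval_wNumer] at h
  have hV : aeval v (vdm D l) ≠ 0 := by
    rw [vdm, map_prod]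
    refine Finset.prod_ne_zero_iff.2 fun p hp => ?_
    simp only [map_sub, aeval_X]
    exact sub_ne_zero.2 fun e => (Finset.mem_filter.1 hp).2.ne (hv e)
  refine (mul_eq_zero.1 (h.trans (Finset.sum_eq_zero fun σ _ => ?_))).resolve_right hV
  refine mul_eq_zero_of_right _ ?_
  obtain ⟨i, rfl⟩ := σ.surjective a
  obtain ⟨j, rfl⟩ := σ.surjective b
  have hij : i ≠ j := fun e => hab (e ▸ rfl)
  -- If `i < j`, either `m i < k` and `G_{m i}` vanishes at `z_k⁻¹`, or `k ≤ m i < m j` and `G_{m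
  -- j}` vanishes at `q² z_k⁻¹`. If `j < i`, the factor `q⁻¹ X - q X'` of the pair `(j, i)` is zero.
  rcases lt_or_gt_of_ne hij with hlt | hlt
  · refine mul_eq_zero_of_left ?_ _
    rcases lt_or_ge (m i) k with hk | hk
    · refine Finset.prod_eq_zero (Finset.mem_univ i) ?_
      rw [ha, Polynomial.aeval_algebraMap_apply, Polynomial.coe_aeval_eq_eval,
        eval_gPoly_inv_of_lt q z hk, map_zero]
    · refine Finset.prod_eq_zero (Finset.mem_univ j) ?_
      rw [hb, Polynomial.aeval_algebraMap_apply, Polynomial.coe_aeval_eq_eval,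
        eval_gPoly_sq_mul_inv_of_lt q z (hk.trans_lt (hm hlt)), map_zero]
  · refine mul_eq_zero_of_right _ (Finset.prod_eq_zero (i := (j, i)) (by simpa using hlt) ?_)
    simp only [ha, hb]
    rw [← map_mul, ← map_mul, ← Units.val_mul, ← Units.val_mul, ← mul_assoc, ← zpow_add]
    simp

theorem apply_perm_le_of_prod_ne_zero {f : Fin l → Fin n} (σ : Equiv.Perm (Fin l))
    (h : ∏ a, Polynomial.aeval (((z (f (σ a)))⁻¹ : Dˣ).val) (gPoly q z (m a)) ≠ 0) (a : Fin l) :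
    f (σ a) ≤ m a := by
  by_contra! hlt
  refine h (Finset.prod_eq_zero (Finset.mem_univ a) ?_)
  rw [Polynomial.coe_aeval_eq_eval, eval_gPoly_inv_of_lt q z hlt]

/-- A surviving summand needs `f (σ a) ≤ m a` for all `a`. The weight hypothesis forces equality
throughout, so `σ` is increasing, hence the identity, and `f = m`. -/
theorem eval_eq_zero_of_weight_le [IsDomain D] (hz : Function.Injective z) (hm : StrictMono m)
    (hw : w * vdm D l = wNumer q z m) {f : Fin l → Fin n} (hf : StrictMono f) (hne : f ≠ m)
    (hwt : ∑ a, (m a).val ≤ ∑ a, (f a).val) :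
    eval (fun a => ((z (f a))⁻¹ : Dˣ).val) w = 0 := by
  rw [← coe_aeval_eq_eval]
  set v : Fin l → D := fun a => ((z (f a))⁻¹ : Dˣ).val with hvdef
  have h := congrArg (aeval v) hw
  rw [map_mul, aeval_wNumer] at h
  have hV : aeval v (vdm D l) ≠ 0 := by
    rw [vdm, map_prod]
    refine Finset.prod_ne_zero_iff.2 fun p hp => ?_
    simp only [map_sub, aeval_X]
    refine sub_ne_zero.2 fun e => (Finset.mem_filter.1 hp).2.ne (hf.injective (hz ?_))
    exact inv_injective (Units.ext e)
  refine (mul_eq_zero.1 (h.trans (Finset.sum_eq_zero fun σ _ => ?_))).resolve_right hV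
  refine mul_eq_zero_of_right _ (mul_eq_zero_of_left ?_ _)
  by_contra h0
  have hle := apply_perm_le_of_prod_ne_zero (f := f) σ h0
  have hsum : ∑ a, (f (σ a)).val = ∑ a, (f a).val := Equiv.sum_comp σ fun a => (f a).val
  have heq : ∀ a, f (σ a) = m a := by
    by_contra! hex
    obtain ⟨a, ha⟩ := hex
    have : ∑ a, (f (σ a)).val < ∑ a, (m a).val :=
      Finset.sum_lt_sum (fun a _ => hle a) ⟨a, Finset.mem_univ _, lt_of_le_of_ne (hle a) (Fin.val_ne_of_ne ha)⟩
    omega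
  have hσ : StrictMono σ := fun a b hab => by
    have := hm hab
    rwa [← heq, ← heq, hf.lt_iff_lt] at this
  have hσ1 : ∀ a, σ a = a := by
    have : (hσ.orderIsoOfSurjective σ σ.surjective) = OrderIso.refl _ := Subsingleton.elim _ _
    exact fun a => DFunLike.congr_fun this a
  exact hne (funext fun a => by rw [← heq a, hσ1])

/-- Here a surviving `σ` satisfies `σ a ≤ a` for all `a`, so only the identity remains. -/
theorem eval_self_mul_vdm (hm : StrictMono m) (hw : w * vdm D l = wNumer q z m) :
    eval (fun a => ((z (m a))⁻¹ : Dˣ).val) w * eval (fun a => ((z (m a))⁻¹ : Dˣ).val) (vdm D l) =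
      (∏ a, (gPoly q z (m a)).eval ((z (m a))⁻¹ : Dˣ).val) *
        ∏ p ∈ ltPairs l, (((q ^ (-1 : ℤ) : Dˣ) : D) * ((z (m p.1))⁻¹ : Dˣ).val -
          ((q ^ (1 : ℤ) : Dˣ) : D) * ((z (m p.2))⁻¹ : Dˣ).val) := by
  rw [← map_mul, hw, ← coe_aeval_eq_eval, RingHom.coe_coe, aeval_wNumer, Finset.sum_eq_single 1]
  · simp [Polynomial.coe_aeval_eq_eval]
  · intro σ _ hσ
    refine mul_eq_zero_of_right _ (mul_eq_zero_of_left ?_ _)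
    by_contra h0
    have hle : ∀ a, σ a ≤ a := fun a => hm.le_iff_le.1 (apply_perm_le_of_prod_ne_zero (f := m) σ h0 a)
    have hsum : ∑ a, (σ a).val = ∑ a, (a : Fin l).val := Equiv.sum_comp σ fun a => a.val
    apply hσ
    ext a
    exact (Finset.sum_eq_sum_iff_of_le (f := fun a => (σ a).val) (g := fun a => a.val)
      fun a _ => hle a).1 hsum a (Finset.mem_univ _)
  · intro h
    exact absurd (Finset.mem_univ _) h

end Weight

end FunctionalModel

end

noncomputable section

namespace FunctionalModel

/-! ### Units of the completed ring -/

section Units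

theorem zero_lt_toLex_single_sub_single {n : ℕ} {i j : Fin n} (hij : i < j) :
    (0 : Exponent n) < toLex (Pi.single i 1 - Pi.single j 1) := by
  refine ⟨i, fun k hk => ?_, ?_⟩
  · have hk' : k < i := hk
    simp [Pi.single_eq_of_ne hk'.ne, Pi.single_eq_of_ne (hk'.trans hij).ne]
    rfl
  · simp [Pi.single_eq_of_ne hij.ne]
    exact zero_lt_one

theorem toLex_single_sub_single_mem_cone {n : ℕ} {i j : Fin n} (hij : i < j) :
    (toLex (Pi.single i 1 - Pi.single j 1) : Exponent n) ∈ cone n := by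
  obtain ⟨j, hj⟩ := j
  induction j with
  | zero => exact absurd hij (Nat.not_lt_zero _)
  | succ j ih =>
    have hj' : j < n := by omega
    have hstep : (toLex (Pi.single ⟨j, hj'⟩ 1 - Pi.single ⟨j + 1, hj⟩ 1) : Exponent n) ∈ cone n :=
      AddSubmonoid.subset_closure ⟨⟨j, hj'⟩, ⟨j + 1, hj⟩, rfl, rfl⟩
    rcases (Nat.lt_succ_iff.1 hij).lt_or_eq with h | h
    · have := (cone n).add_mem (ih hj' h) hstep
      rwa [← toLex_add, sub_add_sub_cancel] at this
    · have : i = ⟨j, hj'⟩ := Fin.ext h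
      rwa [this]

/-- The inverse is the geometric series: `0 < a` makes it summable as a Hahn series, and `a ∈ cone
n` keeps its sum inside `hatRing`. -/
theorem isUnit_one_sub_single {R : Type} [CommRing R] {n : ℕ} {a : Exponent n} (ha : 0 < a)
    (hmem : a ∈ cone n) (c : R) (s : hatRing R n) (hs : s.1 = HahnSeries.single a c) :
    IsUnit (1 - s) := by
  have hpos : 0 < (HahnSeries.single a c).orderTop := HahnSeries.lt_orderTop_single ha
  have hsupp : (HahnSeries.SummableFamily.powers (HahnSeries.single a c)).hsum.support ⊆
      (cone n : Set (Exponent n)) := by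
    refine HahnSeries.SummableFamily.support_hsum_subset.trans (Set.iUnion_subset fun k => ?_)
    rw [HahnSeries.SummableFamily.powers_of_orderTop_pos hpos, HahnSeries.single_pow]
    refine HahnSeries.support_single_subset.trans ?_
    rw [Set.singleton_subset_iff]
    exact (cone n).nsmul_mem hmem k
  refine IsUnit.of_mul_eq_one ⟨_, Algebra.subset_adjoin (Or.inl hsupp)⟩ (Subtype.ext ?_)
  have := HahnSeries.SummableFamily.one_sub_self_mul_hsum_powers hpos
  simpa [hs] using this

theorem algebraMap_hatRing_single {R : Type} [CommRing R] (n : ℕ) (v : Fin n → ℤ) (c : R) :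
    (algebraMap (Laurent R n) (hatRing R n) (AddMonoidAlgebra.single v c)).1 =
      HahnSeries.single (toLex v) c := by
  change (AddMonoidAlgebra.lift R (hatRing R n) (Fin n → ℤ) _ (AddMonoidAlgebra.single v c)).1 = _
  rw [AddMonoidAlgebra.lift_single]
  refine (show _ = c • HahnSeries.single (toLex v) (1 : R) from rfl).trans ?_
  refine HahnSeries.ext (funext fun g => ?_)
  rw [HahnSeries.coeff_smul]
  by_cases hg : g = toLex v
  · rw [hg, HahnSeries.coeff_single_same, HahnSeries.coeff_single_same, smul_eq_mul, mul_one]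
  · rw [HahnSeries.coeff_single_of_ne hg, HahnSeries.coeff_single_of_ne hg, smul_zero]

/-- `z_k` as a unit. -/
def zUnit (R : Type) [CommRing R] (n : ℕ) (k : Fin n) : (Laurent R n)ˣ where
  val := zpowVar R n k 1
  inv := zpowVar R n k (-1)
  val_inv := by
    simp [zpowVar, AddMonoidAlgebra.single_mul_single, ← Pi.single_add,
      AddMonoidAlgebra.one_def]
  inv_val := by
    simp [zpowVar, AddMonoidAlgebra.single_mul_single, ← Pi.single_add,
      AddMonoidAlgebra.one_def]

/-- `q` as a unit of the ring of Laurent polynomials. -/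
def qUnit {R : Type} [CommRing R] (q : Rˣ) (n : ℕ) : (Laurent R n)ˣ :=
  Units.map (algebraMap R (Laurent R n)).toMonoidHom q

theorem val_qUnit_zpow {R : Type} [CommRing R] (q : Rˣ) (n : ℕ) (e : ℤ) :
    ((qUnit q n ^ e : (Laurent R n)ˣ) : Laurent R n) = qpow q n e := by
  rw [qUnit, ← map_zpow]; rfl

theorem isUnit_qpow {R : Type} [CommRing R] (q : Rˣ) (n : ℕ) (e : ℤ) : IsUnit (qpow q n e) :=
  ⟨_, val_qUnit_zpow q n e⟩

theorem isUnit_algebraMap_one_sub {R : Type} [CommRing R] {n : ℕ} {i j : Fin n} (hij : i < j)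
    (c : R) : IsUnit (algebraMap (Laurent R n) (hatRing R n)
      (1 - algebraMap R (Laurent R n) c * (zpowVar R n i 1 * zpowVar R n j (-1)))) := by
  rw [map_sub, map_one]
  refine isUnit_one_sub_single (zero_lt_toLex_single_sub_single hij)
    (toLex_single_sub_single_mem_cone hij) c _ ?_
  have : algebraMap R (Laurent R n) c * (zpowVar R n i 1 * zpowVar R n j (-1)) =
      AddMonoidAlgebra.single (Pi.single i 1 - Pi.single j 1) c := by
    rw [zpowVar, zpowVar, AddMonoidAlgebra.single_mul_single, AddMonoidAlgebra.coe_algebraMap]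
    simp [AddMonoidAlgebra.single_mul_single, sub_eq_add_neg, Pi.single_neg]
  rw [this, algebraMap_hatRing_single]

theorem isUnit_algebraMap_eval_gPoly {R : Type} [CommRing R] (q : Rˣ) {n : ℕ} (m : Fin n) :
    IsUnit (algebraMap (Laurent R n) (hatRing R n)
      ((gPoly (qUnit q n) (zUnit R n) m).eval ((zUnit R n m)⁻¹ : (Laurent R n)ˣ).val)) := by
  rw [← Polynomial.coe_aeval_eq_eval, aeval_gPoly]
  simp only [Algebra.algebraMap_self_apply, map_mul, map_prod]
  refine ((Units.isUnit _).map _).mul (IsUnit.prod_iff.2 fun k hk => ?_) |>.mul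
    (IsUnit.prod_iff.2 fun k hk => ?_)
  · have h := isUnit_algebraMap_one_sub (Finset.mem_filter.1 hk).2 ((q ^ (-2 : ℤ) : Rˣ) : R)
    rw [← mul_assoc] at h
    rwa [val_qUnit_zpow]
  · have h := isUnit_algebraMap_one_sub (Finset.mem_filter.1 hk).2 (1 : R)
    rw [map_one, one_mul] at h
    -- For `m < k` the ratio `z_k/z_m` points the wrong way; extracting the unit `-z_k/z_m` leaves
    -- `1 - z_m/z_k`.
    have h2 : (1 - (zUnit R n k : Laurent R n) * ((zUnit R n m)⁻¹ : (Laurent R n)ˣ).val) =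
        -(((zUnit R n k * (zUnit R n m)⁻¹ : (Laurent R n)ˣ) : Laurent R n) *
          (1 - (zUnit R n m : Laurent R n) * ((zUnit R n k)⁻¹ : (Laurent R n)ˣ).val)) := by
      rw [mul_sub, ← Units.val_mul, ← Units.val_mul, ← Units.val_mul]
      have : zUnit R n k * (zUnit R n m)⁻¹ * (zUnit R n m * (zUnit R n k)⁻¹) = 1 := by group
      rw [this]; simp
    rw [h2, map_neg, map_mul]
    exact (((Units.isUnit _).map _).mul h).neg

theorem isUnit_algebraMap_sub {R : Type} [CommRing R] (q : Rˣ) {n : ℕ} {i j : Fin n}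
    (hij : i < j) :
    IsUnit (algebraMap (Laurent R n) (hatRing R n)
      (((qUnit q n ^ (-1 : ℤ) : (Laurent R n)ˣ) : Laurent R n) *
          ((zUnit R n i)⁻¹ : (Laurent R n)ˣ).val -
        ((qUnit q n ^ (1 : ℤ) : (Laurent R n)ˣ) : Laurent R n) *
          ((zUnit R n j)⁻¹ : (Laurent R n)ˣ).val)) := by
  have h := isUnit_algebraMap_one_sub hij ((q ^ (2 : ℤ) : Rˣ) : R)
  have h2 : ((qUnit q n ^ (-1 : ℤ) : (Laurent R n)ˣ) : Laurent R n) *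
          ((zUnit R n i)⁻¹ : (Laurent R n)ˣ).val -
        ((qUnit q n ^ (1 : ℤ) : (Laurent R n)ˣ) : Laurent R n) *
          ((zUnit R n j)⁻¹ : (Laurent R n)ˣ).val =
      ((qUnit q n ^ (-1 : ℤ) * (zUnit R n i)⁻¹ : (Laurent R n)ˣ) : Laurent R n) *
        (1 - ((qUnit q n ^ (2 : ℤ) : (Laurent R n)ˣ) : Laurent R n) *
          ((zUnit R n i : Laurent R n) * ((zUnit R n j)⁻¹ : (Laurent R n)ˣ).val)) := by
    rw [mul_sub]
    simp only [← Units.val_mul, mul_one]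
    congr 2
    have : qUnit q n ^ (1 : ℤ) = qUnit q n ^ (-1 : ℤ) * qUnit q n ^ (2 : ℤ) := by
      rw [← zpow_add]; norm_num
    rw [this]
    simp only [mul_assoc, mul_left_comm _ (qUnit q n ^ (2 : ℤ))]
    simp
  rw [h2, map_mul, val_qUnit_zpow _ _ 2]
  exact ((Units.isUnit _).map _).mul h

end Units

/-! ### Distinctness of the evaluation points and injectivity of `A → K` -/

section Genericity

theorem zpowVar_injective {R : Type} [CommRing R] [Nontrivial R] {n : ℕ} {e : ℤ} (he : e ≠ 0) :
    Function.Injective fun k => zpowVar R n k e := by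
  intro i j h
  have h' := (AddMonoidAlgebra.single_left_inj (one_ne_zero (α := R))).1 h
  by_contra hij
  have := congrFun h' i
  simp [Pi.single_eq_of_ne hij, he] at this

theorem qpow_mul_zpowVar {R : Type} [CommRing R] (q : Rˣ) (n : ℕ) (e f : ℤ) (k : Fin n) :
    qpow q n e * zpowVar R n k f =
      AddMonoidAlgebra.single (Pi.single k f) ((q ^ e : Rˣ) : R) := by
  rw [qpow, zpowVar, AddMonoidAlgebra.coe_algebraMap]
  simp [AddMonoidAlgebra.single_mul_single]

theorem eq_and_eq_of_qpow_mul_zpowVar_eq {R : Type} [CommRing R] [Nontrivial R] {q : Rˣ} {n : ℕ}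
    {e f : ℤ} (hf : f ≠ 0) {i j : Fin n}
    (h : qpow q n e * zpowVar R n i f = zpowVar R n j f) : i = j ∧ q ^ e = 1 := by
  rw [qpow_mul_zpowVar, zpowVar] at h
  replace h := congrArg AddMonoidAlgebra.coeff h
  rw [AddMonoidAlgebra.coeff_single, AddMonoidAlgebra.coeff_single,
    Finsupp.single_eq_single_iff] at h
  rcases h with ⟨h1, h2⟩ | ⟨h1, -⟩
  · refine ⟨?_, Units.ext h2⟩
    by_contra hij
    have := congrFun h1 i
    simp [Pi.single_eq_of_ne hij, hf] at this
  · exact absurd h1 (Units.ne_zero _)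

theorem qA_sq_ne_one : qA ^ (2 : ℤ) ≠ 1 := by
  intro h
  have h1 : (LaurentPolynomial.T 1 : A) * LaurentPolynomial.T 1 = 1 := by
    rw [zpow_two] at h
    exact congrArg Units.val h
  rw [← LaurentPolynomial.T_add, ← LaurentPolynomial.T_zero] at h1
  have := congrArg (fun f : A => f.coeff 0) h1
  simp [LaurentPolynomial.T_apply] at this

theorem AtoK_injective : Function.Injective AtoK := by
  rw [injective_iff_map_eq_zero]
  intro f hf
  obtain ⟨k, p, hp⟩ := LaurentPolynomial.exists_T_pow f
  have hcomp : ∀ p : Polynomial ℂ, AtoK (Polynomial.toLaurent p) = algebraMap _ K p := by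
    intro p
    induction p using Polynomial.induction_on' with
    | add p r hp hr => simp [hp, hr]
    | monomial k a =>
      rw [← Polynomial.C_mul_X_pow_eq_monomial, Polynomial.toLaurent_C_mul_X_pow, AtoK, LaurentPolynomial.eval₂_C_mul_T]
      rw [map_mul, map_pow]
      simp [qK, RatFunc.algebraMap_X, RatFunc.algebraMap_C]
  have h0 : algebraMap _ K p = 0 := by rw [← hcomp, hp, map_mul, hf, zero_mul]
  have hp0 : p = 0 := (map_eq_zero_iff _ (RatFunc.algebraMap_injective ℂ)).1 h0
  rw [hp0, map_zero] at hp
  exact (LaurentPolynomial.isUnit_T (R := ℂ) (k : ℤ)).mul_left_eq_zero.1 hp.symm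

theorem laurentAtoK_injective (n : ℕ) : Function.Injective (laurentAtoK n) :=
  AddMonoidAlgebra.map_injective AtoK.toAddMonoidHom AtoK_injective

end Genericity

end FunctionalModel

end

noncomputable section

namespace FunctionalModel

open MvPolynomial

instance (n : ℕ) : CharZero (Laurent A n) :=
  charZero_of_injective_algebraMap (FaithfulSMul.algebraMap_injective ℂ (Laurent A n))

/-! ### Membership in the function space -/

section Membership

theorem AtoK_qA_zpow (e : ℤ) : AtoK ((qA ^ e : Aˣ) : A) = ((qK ^ e : Kˣ) : K) := by
  have h : Units.map AtoK.toMonoidHom qA = qK := by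
    ext
    change AtoK (LaurentPolynomial.T 1) = _
    rw [AtoK, LaurentPolynomial.eval₂_T, zpow_one]
  rw [← h, ← map_zpow]
  rfl

theorem map_specializeAt {n l : ℕ} (k : Fin n) (P : MvPolynomial (Fin l) (Laurent A n)) :
    specializeAt qK n l k (map (laurentAtoK n) P) =
      map (laurentAtoK n) (specializeAt qA n l k P) := by
  have hq : laurentAtoK n (qpow qA n 2) = qpow qK n 2 := by
    rw [qpow, qpow, AddMonoidAlgebra.coe_algebraMap, AddMonoidAlgebra.coe_algebraMap]
    simp only [Function.comp, Algebra.algebraMap_self_apply, laurentAtoK,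
      AddMonoidAlgebra.mapRingHom_single]
    congr 1
    exact AtoK_qA_zpow 2
  have hz : ∀ e, laurentAtoK n (zpowVar A n k e) = zpowVar K n k e := fun e => by
    simp [zpowVar, laurentAtoK]
  induction P using MvPolynomial.induction_on with
  | C a => simp [specializeAt, algebraMap_eq]
  | add P Q hP hQ => simp only [map_add, hP, hQ]
  | mul_X P a hP =>
    simp only [map_mul, hP, map_X]
    congr 1
    simp only [specializeAt, aeval_X]
    split_ifs <;> simp [hq, hz]

/-- All three conditions are detected through the injection of coefficients, so the rest of the
argument stays over `A`. -/
theorem mem_FA_iff {n l : ℕ} {P : MvPolynomial (Fin l) (Laurent A n)} :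
    P ∈ FA n l ↔ P ∈ functionSpace qA n l := by
  have hinj := map_injective (σ := Fin l) (laurentAtoK n) (laurentAtoK_injective n)
  have hdeg : ∀ a, degreeOf a (map (laurentAtoK n) P) = degreeOf a P := fun a => by
    rw [degreeOf_eq_sup, degreeOf_eq_sup, support_map_of_injective P (laurentAtoK_injective n)]
  have hsymm : (map (laurentAtoK n) P).IsSymmetric ↔ P.IsSymmetric :=
    ⟨fun h σ => hinj (by rw [map_rename, h σ]), fun h => h.map _⟩
  change (_ ∧ _ ∧ _) ↔ (_ ∧ _ ∧ _)
  simp only [hsymm, hdeg, map_specializeAt, map_eq_zero_iff _ hinj]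

theorem exists_perm_apply_eq {l : ℕ} (hl : 2 ≤ l) {a b : Fin l} (hab : a ≠ b) :
    ∃ σ : Equiv.Perm (Fin l), σ ⟨0, by omega⟩ = a ∧ σ ⟨1, by omega⟩ = b := by
  set i : Fin l := ⟨0, by omega⟩
  set j : Fin l := ⟨1, by omega⟩
  have hij : i ≠ j := by simp [i, j]
  set c := Equiv.swap i a b with hc
  have hci : i ≠ c := fun h => hab (by
    have := congrArg (Equiv.swap i a) h
    simpa [hc] using this)
  refine ⟨Equiv.swap i a * Equiv.swap j c, ?_, ?_⟩
  · rw [Equiv.Perm.mul_apply, Equiv.swap_apply_of_ne_of_ne hij hci, Equiv.swap_apply_left]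
  · rw [Equiv.Perm.mul_apply, Equiv.swap_apply_left, hc, Equiv.swap_apply_self]

theorem eval_eq_zero_of_mem_functionSpace {R : Type} [CommRing R] {q : Rˣ} {n l : ℕ}
    {P : MvPolynomial (Fin l) (Laurent R n)}
    (hP : P ∈ functionSpace q n l) (v : Fin l → Laurent R n) {a b : Fin l} (hab : a ≠ b)
    (k : Fin n) (ha : v a = zpowVar R n k (-1)) (hb : v b = qpow q n 2 * zpowVar R n k (-1)) :
    eval v P = 0 := by
  have hl : 2 ≤ l := by
    have := a.2
    have := b.2
    have := Fin.val_ne_of_ne hab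
    omega
  obtain ⟨σ, h0, h1⟩ := exists_perm_apply_eq hl hab
  -- The permuted point already satisfies `X_1 = q⁻² X_2 = z_k⁻¹`, so specializing first changes
  -- nothing.
  have key : eval (v ∘ σ) P = eval (v ∘ σ) (specializeAt q n l k P) := by
    rw [specializeAt, ← coe_aeval_eq_eval, RingHom.coe_coe, ← AlgHom.comp_apply, comp_aeval]
    congr 2
    ext1 c
    split_ifs with hc0 hc1
    · rw [show c = ⟨0, by omega⟩ from Fin.ext hc0]
      simp [h0, ha]
    · rw [show c = ⟨1, by omega⟩ from Fin.ext hc1]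
      simp [h1, hb]
    · simp
  rw [← eval_comp_perm hP.1 v σ, key, hP.2.2 hl k, map_zero]

theorem mem_functionSpace_of_mul_vdm {n l : ℕ} {m : Fin l → Fin n} (hm : StrictMono m)
    {w : MvPolynomial (Fin l) (Laurent A n)}
    (hw : w * vdm (Laurent A n) l = wNumer (qUnit qA n) (zUnit A n) m) :
    w ∈ functionSpace qA n l := by
  refine ⟨isSymmetric_of_mul_vdm hw, degreeOf_le_of_mul_vdm hw, fun hl k => ?_⟩
  refine aeval_eq_zero_of_mul_vdm hm hw (a := ⟨0, by omega⟩) (b := ⟨1, by omega⟩) ?_ (by simp) k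
    rfl ?_
  · have hCX : ∀ (c : Laurent A n) (a : Fin l), (C c : MvPolynomial (Fin l) (Laurent A n)) ≠ X a :=
      fun c a h => by
        have := congrArg (degreeOf a) h
        simp at this
    have hne : qpow qA n 2 * zpowVar A n k (-1) ≠ zpowVar A n k (-1) := fun h =>
      qA_sq_ne_one (eq_and_eq_of_qpow_mul_zpowVar_eq (by norm_num) h).2
    intro a b hab
    simp only at hab
    apply Fin.ext
    split_ifs at hab with h1 h2 h3 h4 h5 h6
    · omega
    · exact absurd (C_injective _ _ hab).symm hne
    · exact absurd hab (hCX _ _)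
    · exact absurd (C_injective _ _ hab) hne
    · omega
    · exact absurd hab (hCX _ _)
    · exact absurd hab.symm (hCX _ _)
    · exact absurd hab.symm (hCX _ _)
    · exact congrArg Fin.val (X_injective hab)
  · rw [Units.val_mul, val_qUnit_zpow]; rfl

end Membership

/-! ### Agreement with the defining formula -/

section Formula

theorem ratC_eq_algebraMap {n l : ℕ} (c : Laurent A n) :
    ratC n l c = algebraMap (Laurent A n) (RatFn n l) c :=
  (IsScalarTower.algebraMap_apply (Laurent A n) (MvPolynomial (Fin l) (Laurent A n))
    (RatFn n l) c).symm

theorem aeval_ratX {n l : ℕ} (P : MvPolynomial (Fin l) (Laurent A n)) :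
    aeval (ratX n l) P = algebraMap (MvPolynomial (Fin l) (Laurent A n)) (RatFn n l) P := by
  have : aeval (ratX n l) =
      IsScalarTower.toAlgHom (Laurent A n) (MvPolynomial (Fin l) (Laurent A n)) (RatFn n l) := by
    ext a
    simp [ratX]
  rw [this]; rfl

theorem G_eq_aeval_gPoly {n l : ℕ} (m : Fin n) (x : RatFn n l) :
    G n l m x = Polynomial.aeval x (gPoly (qUnit qA n) (zUnit A n) m) := by
  rw [aeval_gPoly, G]
  simp only [val_qUnit_zpow, ratC_eq_algebraMap]
  rfl

theorem algebraMap_eq_wFormula {n l : ℕ} (M : {M : Finset (Fin n) // M.card = l})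
    {w : MvPolynomial (Fin l) (Laurent A n)}
    (hw : w * vdm (Laurent A n) l =
      wNumer (qUnit qA n) (zUnit A n) (M.1.orderEmbOfFin M.2)) :
    algebraMap (MvPolynomial (Fin l) (Laurent A n)) (RatFn n l) w = wFormula n l M := by
  have hinj := IsFractionRing.injective (MvPolynomial (Fin l) (Laurent A n)) (RatFn n l)
  have hV : aeval (ratX n l) (vdm (Laurent A n) l) = ∏ p ∈ ltPairs l,
      (ratX n l p.1 - ratX n l p.2) := by
    simp [vdm]
  have hV0 : ∏ p ∈ ltPairs l, (ratX n l p.1 - ratX n l p.2) ≠ 0 := by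
    rw [← hV, aeval_ratX]
    exact (map_ne_zero_iff _ hinj).2 (vdm_ne_zero l)
  have h := congrArg (aeval (ratX n l)) hw
  rw [map_mul, aeval_wNumer, hV, aeval_ratX] at h
  refine mul_right_cancel₀ hV0 (h.trans ?_)
  rw [wFormula, Finset.sum_mul]
  refine Finset.sum_congr rfl fun σ _ => ?_
  simp only [G_eq_aeval_gPoly, ← ratC_eq_algebraMap, val_qUnit_zpow]
  -- Reordering the denominator produces the sign of `σ`, which matches the sign in `wNumer` because
  -- it is its own inverse.
  rw [Finset.prod_div_distrib, prod_ltPairs_perm (ratX n l) σ]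
  have hs : (((Equiv.Perm.sign σ : ℤˣ) : ℤ) : RatFn n l) *
      (((Equiv.Perm.sign σ : ℤˣ) : ℤ) : RatFn n l) = 1 := by
    rw [← Int.cast_mul, ← Units.val_mul, Int.units_mul_self]; simp
  have hs0 : (((Equiv.Perm.sign σ : ℤˣ) : ℤ) : RatFn n l) ≠ 0 := left_ne_zero_of_mul_eq_one hs
  field_simp
  rw [pow_two, hs, one_mul]

end Formula

/-! ### The matrix of values and the basis -/

section Values

/-- The value of an element of `ℱ_{A,n,l}` at the points `z_m⁻¹`, `m ∈ M`. -/
def valueAt (n l : ℕ) (M : {M : Finset (Fin n) // M.card = l}) :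
    FA n l →ₗ[Laurent A n] Laurent A n :=
  (aeval fun a => zpowVar A n (M.1.orderEmbOfFin M.2 a) (-1)).toLinearMap ∘ₗ (FA n l).subtype

theorem valueAt_apply {n l : ℕ} (M : {M : Finset (Fin n) // M.card = l}) (P : FA n l) :
    valueAt n l M P = eval (fun a => zpowVar A n (M.1.orderEmbOfFin M.2 a) (-1)) P.1 := by
  rw [← coe_aeval_eq_eval]; rfl

theorem eq_zero_of_valueAt_eq_zero {n l : ℕ} (hl : l ≤ n) (P : FA n l)
    (hP : ∀ M, valueAt n l M P = 0) : P = 0 := by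
  have hmem := mem_FA_iff.1 P.2
  refine Subtype.ext (eq_zero_of_eval_injective_eq_zero (fun k => zpowVar A n k (-1))
    (qpow qA n 2) (zpowVar_injective (by norm_num)) ?_ ?_ P.1 ?_ ?_ ?_)
  · intro i j h
    exact zpowVar_injective (by norm_num) ((isUnit_qpow qA n 2).mul_left_cancel h)
  · intro i j hij h
    exact hij (eq_and_eq_of_qpow_mul_zpowVar_eq (by norm_num) h).1
  · intro a
    -- The variable `a` and `l ≤ n` force `0 < n`, so the truncated `n - 1` is strictly below `n`.
    have := hmem.2.1 a
    have := a.2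
    omega
  · intro v a b k hab ha hb
    exact eval_eq_zero_of_mem_functionSpace hmem v hab k ha hb
  · intro f hf
    -- By symmetry an injective tuple may be sorted; `M` is its image and `σ` the sorting
    -- permutation.
    let M : {M : Finset (Fin n) // M.card = l} :=
      ⟨Finset.univ.image f, by rw [Finset.card_image_of_injective _ hf]; simp⟩
    have hex : ∀ a, ∃ b, M.1.orderEmbOfFin M.2 b = f a := fun a => by
      have : f a ∈ Set.range (M.1.orderEmbOfFin M.2) := by
        rw [Finset.range_orderEmbOfFin]
        exact Finset.mem_coe.2 (Finset.mem_image_of_mem f (Finset.mem_univ a))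
      exact this
    choose s hs using hex
    have hsinj : Function.Injective s := fun a b hab => hf (by rw [← hs, ← hs, hab])
    let σ : Equiv.Perm (Fin l) := Equiv.ofBijective s (Finite.injective_iff_bijective.1 hsinj)
    have h := hP M
    rw [valueAt_apply, ← eval_comp_perm hmem.1 _ σ] at h
    rw [← h]
    congr 2
    ext1 a
    exact congrArg (fun k => zpowVar A n k (-1)) (hs a).symm

theorem isUnit_algebraMap_det {n l : ℕ} (w : {M : Finset (Fin n) // M.card = l} → FA n l)
    (hw : ∀ M, (w M).1 * vdm (Laurent A n) l =
      wNumer (qUnit qA n) (zUnit A n) (M.1.orderEmbOfFin M.2)) :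
    IsUnit (algebraMap (Laurent A n) (Ahat n)
      (Matrix.det (Matrix.of fun M N => valueAt n l M (w N)))) := by
  rw [det_eq_prod_diag_of_weight _ fun M => ∑ a, (M.1.orderEmbOfFin M.2 a).val]
  · rw [map_prod, IsUnit.prod_iff]
    intro M _
    have h := eval_self_mul_vdm (M.1.orderEmbOfFin M.2).strictMono (hw M)
    rw [Matrix.of_apply, valueAt_apply]
    -- A factor of a unit is a unit, so the Vandermonde value needs no separate treatment.
    refine isUnit_of_mul_isUnit_left (y := algebraMap (Laurent A n) (Ahat n)
      (eval (fun a => ((zUnit A n (M.1.orderEmbOfFin M.2 a))⁻¹ : (Laurent A n)ˣ).val)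
        (vdm (Laurent A n) l))) ?_
    rw [← map_mul]
    refine (congrArg (fun r => IsUnit (algebraMap (Laurent A n) (Ahat n) r)) h).mpr ?_
    rw [map_mul, map_prod, map_prod]
    refine (IsUnit.prod_iff.2 fun a _ => isUnit_algebraMap_eval_gPoly qA _).mul
      (IsUnit.prod_iff.2 fun p hp => isUnit_algebraMap_sub qA ?_)
    exact (M.1.orderEmbOfFin M.2).strictMono (Finset.mem_filter.1 hp).2
  · intro M N hMN hle
    rw [Matrix.of_apply, valueAt_apply]
    refine eval_eq_zero_of_weight_le (z := zUnit A n) (f := M.1.orderEmbOfFin M.2) ?_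
      (N.1.orderEmbOfFin N.2).strictMono (hw N) (M.1.orderEmbOfFin M.2).strictMono ?_ hle
    · intro i j h
      exact zpowVar_injective one_ne_zero (congrArg Units.val h)
    · intro h
      apply hMN
      have := congrArg Set.range h
      rw [Finset.range_orderEmbOfFin, Finset.range_orderEmbOfFin] at this
      exact Subtype.ext (Finset.coe_injective this)

theorem exists_basis_FAhat {n l : ℕ} (hl : l ≤ n)
    (w : {M : Finset (Fin n) // M.card = l} → FA n l)
    (hw : ∀ M, (w M).1 * vdm (Laurent A n) l =
      wNumer (qUnit qA n) (zUnit A n) (M.1.orderEmbOfFin M.2)) :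
    ∃ b : Module.Basis {M : Finset (Fin n) // M.card = l} (Ahat n) (FAhat n l),
      ∀ M, b M = (1 : Ahat n) ⊗ₜ[Laurent A n] w M := by
  have h := exists_basis_baseChange (S := Ahat n) (valueAt n l) w (eq_zero_of_valueAt_eq_zero hl)
  exact h (isUnit_algebraMap_det w hw)

theorem exists_mem_FA_mul_vdm {n l : ℕ} (M : {M : Finset (Fin n) // M.card = l}) :
    ∃ w : FA n l, w.1 * vdm (Laurent A n) l =
      wNumer (qUnit qA n) (zUnit A n) (M.1.orderEmbOfFin M.2) := by
  obtain ⟨w, hw⟩ := exists_mul_vdm_eq_wNumer (D := Laurent A n) (qUnit qA n) (zUnit A n)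
    two_ne_zero (M.1.orderEmbOfFin M.2)
  exact ⟨⟨w, mem_FA_iff.2
    (mem_functionSpace_of_mul_vdm (M.1.orderEmbOfFin M.2).strictMono hw)⟩, hw⟩

end Values

end FunctionalModel

end

theorem lemma3p1 (n l : ℕ) (hl : l ≤ n) :
    ∃ w : {M : Finset (Fin n) // M.card = l} → FunctionalModel.FA n l,
      (∀ M, algebraMap (MvPolynomial (Fin l) (FunctionalModel.Laurent FunctionalModel.A n))
          (FunctionalModel.RatFn n l) (w M).1 = FunctionalModel.wFormula n l M) ∧
      ∃ b : Module.Basis {M : Finset (Fin n) // M.card = l}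
          (FunctionalModel.Ahat n) (FunctionalModel.FAhat n l),
        ∀ M, b M = (1 : FunctionalModel.Ahat n) ⊗ₜ[FunctionalModel.Laurent FunctionalModel.A n] w M := by
  choose w hw using FunctionalModel.exists_mem_FA_mul_vdm (n := n) (l := l)
  exact ⟨w, fun M => FunctionalModel.algebraMap_eq_wFormula M (hw M),
    FunctionalModel.exists_basis_FAhat hl w hw⟩
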